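/- **Setting.** Let $(\Delta,\mathfrak D,\mathbb P)$ be a probability space, $\mathcal Z$ a set of decisions, $m\ge 1$, and for $i=1,\dots,m$ and $\delta\in\Delta$ let $\mathcal Z_i(\delta)\subseteq\mathcal Z$ be the set of decisions that are appropriate for criterion $i$ under $\delta$. The joint risk of $z\in\mathcal Z$ is $V(z)=\mathbb P\{\delta: z\notin\mathcal Z_i(\delta)\text{ for some }i\}$. A decision scheme $\mathcal M$ assigns a decision $\mathcal M(\mathcal D_1,\dots,\mathcal D_m)\in\mathcal Z$ to any finite (possibly empty) lists $\mathcal D_1,\dots,\mathcal D_m$ of elements of $\Delta$; for every choice of list sizes, the sets $\{(\mathcal D_1,\dots,\mathcal D_m,\delta):\mathcal M(\mathcal D_1,\dots,\mathcal D_m)\in\mathcal Z_i(\delta)\}$ are assumed measurable. For $\boldsymbol N=(N_1,\dots,N_m)$ let $\boldsymbol{\mathcal D}=(\mathcal D_1,\dots,\mathcal D_m)$, where $\mathcal D_i$ consists of $N_i$ scenarios and all scenarios are independent with law $\mathbb P$; the law of $\boldsymbol{\mathcal D}$ is denoted $\mathbb P^{|\boldsymbol N|}$, and $z^\star_{\boldsymbol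 N}=\mathcal M(\boldsymbol{\mathcal D})$. A scenario of $\boldsymbol{\mathcal D}$ is a support scenario if its removal, keeping all the others, changes the decision; $\mathcal S_i$ is the sub-list of the support scenarios in $\mathcal D_i$, and the complexity is $\boldsymbol s^\star_{\boldsymbol N}=(|\mathcal S_1|,\dots,|\mathcal S_m|)$, with $|\boldsymbol s^\star_{\boldsymbol N}|=\sum_i|\mathcal S_i|$. **Assumptions.** (1) *Consistency*: $\mathcal M$ is invariant under permutations within each list; and, for all lists $\mathcal D_i,\widetilde{\mathcal D}_i$, with $\mathcal D_i^+=\mathcal D_i\cup\widetilde{\mathcal D}_i$ (concatenation): if $\mathcal M(\mathcal D_1,\dots,\mathcal D_m)\in\mathcal Z_i(\delta)$ for all $\delta\in\widetilde{\mathcal D}_i$ and all $i$, then $\mathcal M(\mathcal D_1^+,\dots,\mathcal D_m^+)=\mathcal M(\mathcal D_1,\dots,\mathcal D_m)$; if $\mathcal M(\mathcal D_1,\dots,\mathcal D_m)\notin\mathcal Z_i(\delta)$ for some $i$ and some $\delta\in\widetilde{\mathcal D}_i$, then $\mathcal M(\mathcal D_1^+,\dots,\mathcal D_m^+)\ne\mathcal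 M(\mathcal D_1,\dots,\mathcal D_m)$. (2) *Non-degeneracy*: for every $\boldsymbol N\in\{1,2,\dots\}^m$, $\mathcal M(\mathcal S_1,\dots,\mathcal S_m)=\mathcal M(\boldsymbol{\mathcal D})$ with $\mathbb P^{|\boldsymbol N|}$-probability one. (3) *Bounded complexity*: $K\ge 0$ is an integer such that for every $\boldsymbol N\in\{1,2,\dots\}^m$, $|\boldsymbol s^\star_{\boldsymbol N}|\le K$ with $\mathbb P^{|\boldsymbol N|}$-probability one. **Proposition.** Let $\boldsymbol N\in\{1,2,\dots\}^m$, $\underline N=\min_i N_i$ and $\beta\in(0,1)$. For $K<\underline N$, the function $$\psi_{K,\underline N,\underline N}(t)=1-\frac{\beta}{\underline N}\sum_{j=1}^{\underline N-K}\frac{\binom{\underline N-j}{K}}{\binom{\underline N}{K}}\,t^{-j}$$ has exactly one zero in $(0,\infty)$, and it lies in $(0,1)$. Let $t_K$ be this zero if $K<\underline N$, and $t_K=0$ if $K\ge\underline N$. Then $$\mathbb P^{|\boldsymbol N|}\bigl\{V(z^\star_{\boldsymbol N})\le\hat\varepsilon(K)\bigr\}\ge 1-\beta,\qquad \hat\varepsilon(K)=\min\bigl\{m\,(1-\sqrt[m]{t_K}),\,1\bigr\}.$$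 The bound $\hat\varepsilon(K)$ depends only on $K$, $\underline N$, $\beta$ and $m$, and it is a worst case in the following sense. For $\boldsymbol k\le\boldsymbol n$ in $\{0,1,\dots\}^m$ (componentwise), with all $n_i\ge1$, let $\bar t_{\boldsymbol k,\boldsymbol n}=0$ if $k_i=n_i$ for some $i$, and otherwise let $\bar t_{\boldsymbol k,\boldsymbol n}$ be the unique positive zero of $$\psi_{\boldsymbol k,\boldsymbol n,\boldsymbol n}(t)=1-\frac{\beta}{\min_i n_i}\sum_{j=1}^{\min_i(n_i-k_i)}\Bigl(\prod_{i=1}^m\frac{\binom{n_i-j}{k_i}}{\binom{n_i}{k_i}}\Bigr)t^{-j};$$ let $\bar\varepsilon_{\boldsymbol n}(\boldsymbol k)=\min\{m(1-\sqrt[m]{\bar t_{\boldsymbol k,\boldsymbol n}}),1\}$. Then $\bar\varepsilon_{\boldsymbol N}(\boldsymbol k)\le\hat\varepsilon(K)$ for all $\boldsymbol 0\le\boldsymbol k\le\boldsymbol N$ with $\sum_ik_i\le K$; and, if $K\le\underline N$, then $\bar\varepsilon_{(\underline N,\dots,\underline N)}(K\boldsymbol e_i)=\hat\varepsilon(K)$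 for each $i$, where $\boldsymbol e_i$ is the $i$-th unit vector, i.e. all $K$ support scenarios lie in one of $m$ datasets of size $\underline N$. -/

import Mathlib

open MeasureTheory

namespace ScenarioApproach

/-! ### Decision schemes, risks, support scenarios

`m` criteria; `Z i δ` is the set of decisions that are appropriate for criterion `i` under the
realization `δ`. The `i`-th dataset is a finite list of realizations, the label of a scenario being
the index `i` of the list that it belongs to. A decision scheme maps every family of `m` finite lists
(some of which may be empty) to a decision. -/

section Scheme

variable {m : ℕ} {Δ 𝒵 : Type*}

/-- Permutation invariance, stability in case of confirmation, responsiveness to contradiction. -/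
structure IsConsistentScheme (Z : Fin m → Δ → Set 𝒵) (M : (Fin m → List Δ) → 𝒵) : Prop where
  perm_invariant : ∀ D D' : Fin m → List Δ, (∀ i, (D i).Perm (D' i)) → M D' = M D
  stable : ∀ D E : Fin m → List Δ, (∀ i, ∀ δ ∈ E i, M D ∈ Z i δ) →
    M (fun i => D i ++ E i) = M D
  responsive : ∀ D E : Fin m → List Δ, (∃ i, ∃ δ ∈ E i, M D ∉ Z i δ) →
    M (fun i => D i ++ E i) ≠ M D

/-- The `j`-th scenario of the `i`-th dataset is a support scenario: removing it, and keeping all the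
others, changes the decision. -/
def IsSupport (M : (Fin m → List Δ) → 𝒵) (D : Fin m → List Δ) (i : Fin m)
    (j : Fin (D i).length) : Prop :=
  M (Function.update D i ((D i).eraseIdx j)) ≠ M D

open Classical in
/-- The sub-list of the support scenarios of each dataset. -/
noncomputable def supportList (M : (Fin m → List Δ) → 𝒵) (D : Fin m → List Δ) (i : Fin m) : List Δ :=
  ((List.finRange (D i).length).filter (fun j => decide (IsSupport M D i j))).map (D i).get

/-- The complexity: the number of support scenarios of each dataset. -/
noncomputable def complexity (M : (Fin m → List Δ) → 𝒵) (D : Fin m → List Δ) (i : Fin m) : ℕ :=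
  (supportList M D i).length

/-- Datasets of sizes `N 0, …, N (m - 1)`. -/
abbrev Data (Δ : Type*) (N : Fin m → ℕ) : Type _ := (i : Fin m) → Fin (N i) → Δ

/-- The list of lists given by the datasets. -/
def toLists {N : Fin m → ℕ} (D : Data Δ N) : Fin m → List Δ := fun i => List.ofFn (D i)

variable [MeasurableSpace Δ]

/-- The law of i.i.d. datasets of sizes `N`: the product of `∑ i, N i` copies of `P`. -/
noncomputable def dataLaw (P : Measure Δ) (N : Fin m → ℕ) : Measure (Data Δ N) :=
  Measure.pi fun i => Measure.pi fun _ : Fin (N i) => P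

/-- The joint risk of a decision: the probability that it is inappropriate for some criterion. -/
noncomputable def jointRisk (P : Measure Δ) (Z : Fin m → Δ → Set 𝒵) (z : 𝒵) : ℝ :=
  P.real {δ | ∃ i, z ∉ Z i δ}

/-- Measurability of the events in the decision problem: for datasets of any size, the appropriateness
of the resulting decision for a criterion under a new realization is a jointly measurable event. -/
def IsMeasurableScheme (Z : Fin m → Δ → Set 𝒵) (M : (Fin m → List Δ) → 𝒵) : Prop :=
  ∀ (N : Fin m → ℕ) (i : Fin m),
    MeasurableSet {p : Data Δ N × Δ | M (toLists p.1) ∈ Z i p.2}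

/-- Non-degeneracy: for all (positive) sizes of the datasets, the support scenarios alone almost surely
give the same decision as the whole datasets. -/
def IsNonDegenerate (P : Measure Δ) (M : (Fin m → List Δ) → 𝒵) : Prop :=
  ∀ N : Fin m → ℕ, (∀ i, 1 ≤ N i) →
    ∀ᵐ D ∂(dataLaw P N), M (supportList M (toLists D)) = M (toLists D)

/-- The total complexity is at most `K` (almost surely), for all (positive) sizes of the datasets. -/
def HasComplexityBound (P : Measure Δ) (M : (Fin m → List Δ) → 𝒵) (K : ℕ) : Prop :=
  ∀ N : Fin m → ℕ, (∀ i, 1 ≤ N i) →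
    ∀ᵐ D ∂(dataLaw P N), ∑ i, complexity M (toLists D) i ≤ K

end Scheme

/-! ### The bounds -/

/-- `ψ_{K,n,n}(t) = 1 - (β / n) ∑_{j=1}^{n-K} [C(n-j,K) / C(n,K)] t^{-j}`. -/
noncomputable def psi (β : ℝ) (K n : ℕ) (t : ℝ) : ℝ :=
  1 - β / n * ∑ j ∈ Finset.Icc 1 (n - K),
    ((n - j).choose K : ℝ) / (n.choose K : ℝ) * t ^ (-(j : ℤ))

/-- The multi-index function `ψ_{k,N,N}`, for `k ≤ N`:
`1 - (β / min N) ∑_{j=1}^{min (N-k)} ∏ i, [C(N i - j, k i) / C(N i, k i)] t^{-j}`. -/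
noncomputable def psiVec {m : ℕ} (β : ℝ) (k N : Fin m → ℕ) (t : ℝ) : ℝ :=
  1 - β / ((⨅ i, N i : ℕ) : ℝ) * ∑ j ∈ Finset.Icc 1 (⨅ i, (N i - k i)),
    (∏ i, ((N i - j).choose (k i) : ℝ) / ((N i).choose (k i) : ℝ)) * t ^ (-(j : ℤ))

/-- The zero of `f` on the positive half-line, when there is exactly one. -/
noncomputable def posZero (f : ℝ → ℝ) : ℝ := sSup {t | 0 < t ∧ f t = 0}

/-- `t_K`: the zero of `ψ_{K,n,n}` if `K < n`, and `0` otherwise. -/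
noncomputable def tLow (β : ℝ) (K n : ℕ) : ℝ := if K < n then posZero (psi β K n) else 0

open Classical in
/-- `t_k` for a multi-index `k`: the zero of `ψ_{k,N,N}` if `k i < N i` for all `i`, and `0` otherwise. -/
noncomputable def tVec {m : ℕ} (β : ℝ) (k N : Fin m → ℕ) : ℝ :=
  if ∀ i, k i < N i then posZero (psiVec β k N) else 0

/-- `min {m (1 - t^{1/m}), 1}`. -/
noncomputable def epsOf (m : ℕ) (t : ℝ) : ℝ := min (m * (1 - t ^ ((1 : ℝ) / m))) 1

/-- The a-priori bound, as a function of `m`, `β`, the bound `K` on the total complexity, and the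
smallest size `n` of the datasets. -/
noncomputable def epsApriori (m : ℕ) (β : ℝ) (K n : ℕ) : ℝ := epsOf m (tLow β K n)

/-- The a-posteriori bound for datasets of sizes `N` and complexity `k`. -/
noncomputable def epsPosteriori {m : ℕ} (β : ℝ) (k N : Fin m → ℕ) : ℝ := epsOf m (tVec β k N)

end ScenarioApproach

open ScenarioApproach

open ScenarioApproach

/-! Let q_i(z) be the probability that z is appropriate for criterion i. By the union bound and the
AM-GM inequality, ∏ q_i ≥ t forces V(z) ≤ m(1 - t^(1/m)) (`jointRisk_dec_le`), so it suffices that ∏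
q_i of the final decision is below t_K with probability at most β
(`measureReal_prod_reliability_lt_le`).

For selections S ≤ T of scenario positions, consider the event that S is minimal (each of its
scenarios is of support within S), its decision has ∏ q_i < t_K, and T yields the same decision. By
consistency the last condition says exactly that the scenarios of T outside S are appropriate for
the decision of S. By independence the probability is therefore the integral of ∏ q_i^(|T_i|-|S_i|)
over an event that depends on S alone (`measureReal_confirmedEvent`). For fixed T, non-degeneracy
leaves almost surely a single minimal S that reproduces the decision of T, so these probabilities
sum to at most 1 over S (`sum_measureReal_confirmedEvent_le_one`). For T the full data they cover
the bad event.

The function ψ transfers mass from the full data to smaller T. On the bad event ψ ≤ 0 at ∏ q_i.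
Multiplying by ∏ q_i^(N_i-|S_i|) bounds the integrand for the full data by β/n times a sum over j of
the integrands for T with j scenarios deleted from every dataset, where n is the smallest size; the
weights are at most the fraction of such T that contain S (`prod_pow_le_of_prod_lt_tLow`). Summed
over S, each j contributes at most 1, and there are n - K ≤ n values of j, which gives β.

One ψ serves all complexities of total at most K because its coefficients are the smallest ones
(`choose_ratio_le_prod`). The same comparison gives the worst-case claim: larger coefficients move
the zero up, and the bound on the risk decreases in the zero. -/

namespace ScenarioApproach

/-! ### Consistency and support scenarios, for fixed data. -/

section Combinatorics

variable {m : ℕ} {Δ 𝒵 : Type*}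

/-- A decision scheme, evaluated at multisets of scenarios. -/
noncomputable def msetScheme (M : (Fin m → List Δ) → 𝒵) (A : Fin m → Multiset Δ) : 𝒵 :=
  M fun i => (A i).toList

lemma IsConsistentScheme.msetScheme_coe {Z : Fin m → Δ → Set 𝒵} {M : (Fin m → List Δ) → 𝒵}
    (h : IsConsistentScheme Z M) (D : Fin m → List Δ) :
    msetScheme M (fun i => (D i : Multiset Δ)) = M D :=
  h.perm_invariant _ _ fun _ => (Multiset.coe_eq_coe.1 (Multiset.coe_toList _)).symm

lemma IsConsistentScheme.msetScheme_add_eq_iff {Z : Fin m → Δ → Set 𝒵}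
    {M : (Fin m → List Δ) → 𝒵} (h : IsConsistentScheme Z M) (A E : Fin m → Multiset Δ) :
    msetScheme M (A + E) = msetScheme M A ↔ ∀ i, ∀ δ ∈ E i, msetScheme M A ∈ Z i δ := by
  have hadd : msetScheme M (A + E) = M (fun i => (A i).toList ++ (E i).toList) := by
    rw [← h.msetScheme_coe]
    congr 1
    ext1 i
    simp [← Multiset.coe_add]
  rw [hadd]
  constructor
  · intro heq
    by_contra! hcon
    obtain ⟨i, δ, hδ, hz⟩ := hcon
    exact h.responsive (fun i => (A i).toList) (fun i => (E i).toList)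
      ⟨i, δ, Multiset.mem_toList.2 hδ, hz⟩ heq
  · intro hall
    exact h.stable (fun i => (A i).toList) (fun i => (E i).toList)
      fun i δ hδ => hall i δ (Multiset.mem_toList.1 hδ)

/-- A choice of some of the scenarios of each dataset. -/
abbrev Selection (N : Fin m → ℕ) : Type := (i : Fin m) → Finset (Fin (N i))

variable {N : Fin m → ℕ}

/-- The decision based on the selected scenarios. -/
noncomputable def dec (M : (Fin m → List Δ) → 𝒵) (S : Selection N) (D : Data Δ N) : 𝒵 :=
  msetScheme M fun i => (S i).val.map (D i)

/-- The selection without the `j`-th scenario of the `i`-th dataset. -/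
def del (S : Selection N) (i : Fin m) (j : Fin (N i)) : Selection N :=
  Function.update S i ((S i).erase j)

lemma del_le (S : Selection N) (i : Fin m) (j : Fin (N i)) : del S i j ≤ S := by
  intro l
  rcases eq_or_ne l i with rfl | hl
  · simp [del, Finset.erase_subset]
  · simp [del, hl]

lemma le_del {S T : Selection N} (hST : S ≤ T) {i : Fin m} {j : Fin (N i)} (hj : j ∉ S i) :
    S ≤ del T i j := by
  intro l
  rcases eq_or_ne l i with rfl | hl
  · simpa [del, Finset.subset_erase] using ⟨hST l, hj⟩
  · simpa [del, hl] using hST l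

lemma del_mono {S T : Selection N} (hST : S ≤ T) (i : Fin m) (j : Fin (N i)) :
    del S i j ≤ del T i j := by
  intro l
  rcases eq_or_ne l i with rfl | hl
  · simpa [del] using Finset.erase_subset_erase j (hST l)
  · simpa [del, hl] using hST l

/-- All the selected scenarios are support scenarios with respect to the selection. -/
def IsMinimal (M : (Fin m → List Δ) → 𝒵) (S : Selection N) (D : Data Δ N) : Prop :=
  ∀ i, ∀ j ∈ S i, dec M (del S i j) D ≠ dec M S D

/-- The support scenarios in `S`, all of which are support scenarios in `T`, determine the decision
based on `T`. -/
structure IsSupportSelection (M : (Fin m → List Δ) → 𝒵) (S T : Selection N) (D : Data Δ N) :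
    Prop where
  le : S ≤ T
  support : ∀ i, ∀ j ∈ S i, dec M (del T i j) D ≠ dec M T D
  dec_eq : dec M S D = dec M T D

variable {Z : Fin m → Δ → Set 𝒵} {M : (Fin m → List Δ) → 𝒵}

/-- Stability and responsiveness together. This turns equality of decisions, in a set without
σ-algebra, into conditions on individual scenarios; measurability and the use of independence both
rest on it. -/
lemma IsConsistentScheme.dec_eq_iff (h : IsConsistentScheme Z M) {S T : Selection N} (hST : S ≤ T)
    (D : Data Δ N) :
    dec M S D = dec M T D ↔ ∀ i, ∀ j ∈ T i \ S i, dec M S D ∈ Z i (D i j) := by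
  have hadd : dec M T D = msetScheme M ((fun i => (S i).val.map (D i)) +
      fun i => (T i \ S i).val.map (D i)) := by
    unfold dec
    congr 1
    ext1 i
    simp only [Pi.add_apply]
    rw [← Multiset.map_add, Finset.sdiff_val, add_tsub_cancel_of_le (Finset.val_le_iff.2 (hST i))]
  rw [eq_comm, hadd]
  unfold dec
  rw [h.msetScheme_add_eq_iff]
  simp only [Multiset.mem_map, Finset.mem_val, forall_exists_index, and_imp,
    forall_apply_eq_imp_iff₂]

lemma IsConsistentScheme.dec_eq_of_between (h : IsConsistentScheme Z M) {S T U : Selection N}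
    (hST : S ≤ T) (hTU : T ≤ U) {D : Data Δ N} (heq : dec M S D = dec M U D) :
    dec M T D = dec M U D := by
  rw [← heq, eq_comm, h.dec_eq_iff hST]
  intro i j hj
  refine (h.dec_eq_iff (hST.trans hTU) D).1 heq i j ?_
  rw [Finset.mem_sdiff] at hj ⊢
  exact ⟨hTU i hj.1, hj.2⟩

/-- If a scenario of `S` could be dropped from `S` without effect, then the intermediate selection
`del T i j` would also give the decision of `T`, against its being of support in `T`. -/
lemma IsSupportSelection.isMinimal (h : IsConsistentScheme Z M) {S T : Selection N}
    {D : Data Δ N} (hS : IsSupportSelection M S T D) : IsMinimal M S D := by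
  intro i j hj heq
  refine hS.support i j hj ?_
  have hle := del_mono hS.le i j
  exact h.dec_eq_of_between hle (del_le T i j) (heq.trans hS.dec_eq)

/-- Uniqueness, by sandwiching. A scenario of `S` missing from `S'` could be deleted from `T`
without effect; a scenario of `S'` missing from `S` could be deleted from `S'` without effect. -/
lemma IsSupportSelection.eq_of_isMinimal (h : IsConsistentScheme Z M) {S S' T : Selection N}
    {D : Data Δ N} (hS : IsSupportSelection M S T D) (hS'T : S' ≤ T) (hmin : IsMinimal M S' D)
    (hdec : dec M S' D = dec M T D) : S' = S := by
  have hle : S ≤ S' := by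
    intro i j hj
    by_contra hj'
    exact hS.support i j hj
      (h.dec_eq_of_between (le_del hS'T hj') (del_le T i j) hdec)
  refine le_antisymm (fun i j hj => ?_) hle
  by_contra hj'
  exact hmin i j hj ((h.dec_eq_of_between (le_del hle hj') ((del_le S' i j).trans hS'T)
    hS.dec_eq).trans hdec.symm)

lemma coe_map_get_filter_finRange {α : Type*} {n : ℕ} (f : Fin n → α)
    (p : Fin (List.ofFn f).length → Prop) [DecidablePred p] :
    ((((List.finRange (List.ofFn f).length).filter fun j => decide (p j)).map (List.ofFn f).get :
      List α) : Multiset α) =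
    (Finset.univ.filter fun j : Fin n => p (j.cast (List.length_ofFn).symm)).val.map f := by
  have h1 : (((List.finRange (List.ofFn f).length).filter fun j => decide (p j) :
      List _) : Multiset _) = (Finset.univ.filter p).val := by
    rw [Finset.filter_val, ← Multiset.filter_coe]
    rfl
  have h2 : Finset.univ.filter p = (Finset.univ.filter fun j : Fin n =>
      p (j.cast (List.length_ofFn).symm)).map
        (finCongr (List.length_ofFn (f := f)).symm).toEmbedding := by
    ext j
    simp only [Finset.mem_filter, Finset.mem_univ, true_and, Finset.mem_map]
    constructor
    · intro hj
      exact ⟨j.cast List.length_ofFn, by simpa using hj, by simp⟩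
    · rintro ⟨a, ha, rfl⟩
      simpa using ha
  rw [← Multiset.map_coe, h1, h2, Finset.map_val, Multiset.map_map]
  refine Multiset.map_congr rfl fun j _ => ?_
  simp

lemma coe_eraseIdx_ofFn {α : Type*} {n : ℕ} (f : Fin n → α) (j : Fin n) :
    (((List.ofFn f).eraseIdx j : List α) : Multiset α) = (Finset.univ.erase j).val.map f := by
  have h1 : f j ::ₘ (((List.ofFn f).eraseIdx j : List α) : Multiset α) = (List.ofFn f : List α) := by
    have := List.getElem_cons_eraseIdx_perm (l := List.ofFn f) (n := j) (by simp)
    rw [Multiset.cons_coe]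
    simpa using this
  have h2 : f j ::ₘ (Finset.univ.erase j).val.map f = (List.ofFn f : List α) := by
    rw [← Multiset.map_cons, Finset.erase_val, Multiset.cons_erase (Finset.mem_univ j)]
    simp [Finset.univ, Fintype.elems, List.map_ofFn, ← List.ofFn_id]
  exact (Multiset.cons_inj_right (f j)).1 (h1.trans h2.symm)

lemma IsConsistentScheme.dec_top (h : IsConsistentScheme Z M) (D : Data Δ N) :
    dec M ⊤ D = M (toLists D) := by
  rw [← h.msetScheme_coe]
  unfold dec toLists
  congr 1
  ext1 i
  simp [Finset.univ, Fintype.elems, List.map_ofFn, ← List.ofFn_id]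

lemma IsConsistentScheme.isSupport_iff (h : IsConsistentScheme Z M) (D : Data Δ N) (i : Fin m)
    (j : Fin (N i)) :
    IsSupport M (toLists D) i (j.cast (List.length_ofFn).symm) ↔
      dec M (del ⊤ i j) D ≠ dec M ⊤ D := by
  rw [IsSupport, h.dec_top, ← h.msetScheme_coe]
  unfold dec
  refine not_congr (Eq.congr_left ?_)
  congr 1
  ext1 l
  rcases eq_or_ne l i with rfl | hl
  · simpa [del, toLists] using coe_eraseIdx_ofFn (D l) j
  · simp [del, hl, toLists, Finset.univ, Fintype.elems, List.map_ofFn, ← List.ofFn_id]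

-- Passes from sub-lists of values to sets of positions, so that repeated values in the data cause
-- no ambiguity.
open Classical in
lemma IsConsistentScheme.exists_isSupportSelection_top (h : IsConsistentScheme Z M) {D : Data Δ N}
    (hnd : M (supportList M (toLists D)) = M (toLists D)) :
    ∃ S : Selection N, IsSupportSelection M S ⊤ D ∧
      ∀ i, (S i).card = complexity M (toLists D) i := by
  have hS : ∀ i, (supportList M (toLists D) i : Multiset Δ) =
      (Finset.univ.filter fun j => dec M (del ⊤ i j) D ≠ dec M ⊤ D).val.map (D i) := by
    intro i
    have := coe_map_get_filter_finRange (D i) fun j => IsSupport M (toLists D) i j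
    refine Eq.trans ?_ (this.trans ?_)
    · rfl
    · exact congrArg (fun s : Finset (Fin (N i)) => s.val.map (D i))
        (Finset.filter_congr fun j _ => h.isSupport_iff D i j)
  refine ⟨fun i => Finset.univ.filter fun j => dec M (del ⊤ i j) D ≠ dec M ⊤ D,
    ⟨le_top, fun i j hj => (Finset.mem_filter.1 hj).2, ?_⟩, fun i => ?_⟩
  · have hdec : M (supportList M (toLists D)) = msetScheme M fun i =>
        (Finset.univ.filter fun j => dec M (del ⊤ i j) D ≠ dec M ⊤ D).val.map (D i) := by
      rw [← h.msetScheme_coe]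
      simp only [hS]
    exact hdec.symm.trans (hnd.trans (h.dec_top D).symm)
  · rw [complexity, ← Multiset.coe_card, hS, Multiset.card_map]
    rfl

/-- The selected scenarios as datasets. -/
def restrict {n : Fin m → ℕ} (e : ∀ i, Fin (n i) ↪ Fin (N i)) (D : Data Δ N) : Data Δ n :=
  fun i j => D i (e i j)

lemma dec_restrict {n : Fin m → ℕ} (e : ∀ i, Fin (n i) ↪ Fin (N i)) (D : Data Δ N)
    (S : Selection n) : dec M S (restrict e D) = dec M (fun i => (S i).map (e i)) D := by
  unfold dec
  congr 1
  ext1 i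
  rw [Finset.map_val, Multiset.map_map]
  rfl

lemma IsSupportSelection.map {n : Fin m → ℕ} (e : ∀ i, Fin (n i) ↪ Fin (N i)) {D : Data Δ N}
    {S T : Selection n} (hS : IsSupportSelection M S T (restrict e D)) :
    IsSupportSelection M (fun i => (S i).map (e i)) (fun i => (T i).map (e i)) D where
  le := fun i => Finset.map_subset_map.2 (hS.le i)
  support := by
    intro i j hj
    obtain ⟨a, ha, rfl⟩ := Finset.mem_map.1 hj
    have := hS.support i a ha
    rw [dec_restrict, dec_restrict] at this
    have hdel : del (fun i => (T i).map (e i)) i (e i a) =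
        fun l => (del T i a l).map (e l) := by
      ext1 l
      rcases eq_or_ne l i with rfl | hl
      · simp [del, Finset.map_erase]
      · simp [del, hl]
    rwa [hdel]
  dec_eq := by
    have := hS.dec_eq
    rwa [dec_restrict, dec_restrict] at this

/-- The datasets that agree with `x` on the selection and with `y` off it. -/
def merge (S : Selection N) (x y : Data Δ N) : Data Δ N :=
  fun i j => if j ∈ S i then x i j else y i j

lemma dec_merge (M : (Fin m → List Δ) → 𝒵) {S S' : Selection N} (hS : S' ≤ S) (x y : Data Δ N) :
    dec M S' (merge S x y) = dec M S' x := by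
  unfold dec
  congr 1
  ext1 i
  refine Multiset.map_congr rfl fun j hj => ?_
  have hj' : j ∈ S i := hS i hj
  simp [merge, hj']

lemma isMinimal_merge (M : (Fin m → List Δ) → 𝒵) (S : Selection N) (x y : Data Δ N) :
    IsMinimal M S (merge S x y) ↔ IsMinimal M S x := by
  unfold IsMinimal
  simp_rw [dec_merge M le_rfl, dec_merge M (del_le S _ _)]

end Combinatorics

/-! ### Independence, measurability, and the probability of confirmation. -/

section Law

variable {m : ℕ} {Δ 𝒵 : Type*} [MeasurableSpace Δ] {N : Fin m → ℕ}

instance (P : Measure Δ) [IsProbabilityMeasure P] : IsProbabilityMeasure (dataLaw P N) := by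
  unfold dataLaw; infer_instance

lemma dataLaw_box (P : Measure Δ) [IsProbabilityMeasure P] (B : ∀ i, Fin (N i) → Set Δ) :
    dataLaw P N {D | ∀ i j, D i j ∈ B i j} = ∏ i, ∏ j, P (B i j) := by
  have : {D : Data Δ N | ∀ i j, D i j ∈ B i j} =
      Set.univ.pi fun i => Set.univ.pi fun j => B i j := by
    ext D; simp [Set.mem_pi]
  rw [this, dataLaw, Measure.pi_pi]
  simp_rw [Measure.pi_pi]

lemma dataLaw_eq_of_box (P : Measure Δ) [IsProbabilityMeasure P] (ν : Measure (Data Δ N))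
    (hν : ∀ B : ∀ i, Fin (N i) → Set Δ, (∀ i j, MeasurableSet (B i j)) →
      ν {D | ∀ i j, D i j ∈ B i j} = ∏ i, ∏ j, P (B i j)) : dataLaw P N = ν := by
  refine Measure.pi_eq_generateFrom (fun i => generateFrom_pi) (fun i => isPiSystem_pi)
    (fun i => Measure.FiniteSpanningSetsIn.pi
      fun _ => P.toFiniteSpanningSetsIn) ?_
  intro s hs
  choose B hB hBs using hs
  have hB' : ∀ i j, MeasurableSet (B i j) := fun i j => hB i j (Set.mem_univ j)
  have : Set.univ.pi s = {D : Data Δ N | ∀ i j, D i j ∈ B i j} := by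
    ext D; simp [Set.mem_pi, ← hBs]
  rw [this, hν B hB']
  refine Finset.prod_congr rfl fun i _ => ?_
  rw [← hBs i, Measure.pi_pi]

lemma measurable_restrict {n : Fin m → ℕ} (e : ∀ i, Fin (n i) ↪ Fin (N i)) :
    Measurable (restrict e : Data Δ N → Data Δ n) := by
  unfold restrict
  fun_prop

lemma measurePreserving_restrict (P : Measure Δ) [IsProbabilityMeasure P] {n : Fin m → ℕ}
    (e : ∀ i, Fin (n i) ↪ Fin (N i)) :
    MeasurePreserving (restrict e) (dataLaw P N) (dataLaw P n) := by
  classical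
  refine ⟨measurable_restrict e, (dataLaw_eq_of_box P _ fun B hB => ?_).symm⟩
  rw [Measure.map_apply (measurable_restrict e)]
  · have : restrict e ⁻¹' {D : Data Δ n | ∀ i j, D i j ∈ B i j} =
        {D : Data Δ N | ∀ i j, D i j ∈ Function.extend (e i) (B i) (fun _ => Set.univ) j} := by
      ext D
      simp only [Set.mem_preimage, Set.mem_ofPred_eq, restrict]
      refine forall_congr' fun i => ⟨fun h j => ?_, fun h j => ?_⟩
      · by_cases hj : ∃ a, e i a = j
        · obtain ⟨a, rfl⟩ := hj
          rw [(e i).injective.extend_apply]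
          exact h a
        · rw [Function.extend_apply' _ _ _ hj]
          exact Set.mem_univ _
      · have := h (e i j)
        rwa [(e i).injective.extend_apply] at this
    rw [this, dataLaw_box]
    refine Finset.prod_congr rfl fun i _ => ?_
    rw [← Finset.prod_subset (Finset.subset_univ (Finset.univ.map (e i))), Finset.prod_map]
    · simp [(e i).injective.extend_apply]
    · intro j _ hj
      rw [Function.extend_apply' _ _ _ (by simpa using hj)]
      simp
  · have : {D : Data Δ n | ∀ i j, D i j ∈ B i j} = ⋂ i, ⋂ j, {D | D i j ∈ B i j} := by
      ext; simp
    rw [this]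
    exact MeasurableSet.iInter fun i => MeasurableSet.iInter fun j =>
      measurableSet_preimage (by fun_prop) (hB i j)

lemma measurable_merge (S : Selection N) :
    Measurable fun p : Data Δ N × Data Δ N => merge S p.1 p.2 := by
  unfold merge
  refine measurable_pi_lambda _ fun i => measurable_pi_lambda _ fun j => ?_
  split_ifs <;> fun_prop

/-- Resampling the scenarios outside `S` from an independent copy keeps the law; this makes
conditioning on the scenarios of `S` an application of Fubini. -/
lemma measurePreserving_merge (P : Measure Δ) [IsProbabilityMeasure P] (S : Selection N) :
    MeasurePreserving (fun p : Data Δ N × Data Δ N => merge S p.1 p.2)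
      ((dataLaw P N).prod (dataLaw P N)) (dataLaw P N) := by
  refine ⟨measurable_merge S, (dataLaw_eq_of_box P _ fun B hB => ?_).symm⟩
  rw [Measure.map_apply (measurable_merge S)]
  · have : (fun p : Data Δ N × Data Δ N => merge S p.1 p.2) ⁻¹'
          {D : Data Δ N | ∀ i j, D i j ∈ B i j} =
        {D : Data Δ N | ∀ i j, D i j ∈ if j ∈ S i then B i j else Set.univ} ×ˢ
        {D : Data Δ N | ∀ i j, D i j ∈ if j ∈ S i then Set.univ else B i j} := by
      ext ⟨x, y⟩
      simp only [Set.mem_preimage, Set.mem_ofPred_eq, merge, Set.mem_prod, ← forall_and]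
      refine forall_congr' fun i => forall_congr' fun j => ?_
      split_ifs <;> simp
    rw [this, Measure.prod_prod, dataLaw_box, dataLaw_box, ← Finset.prod_mul_distrib]
    refine Finset.prod_congr rfl fun i _ => ?_
    rw [← Finset.prod_mul_distrib]
    refine Finset.prod_congr rfl fun j _ => ?_
    split_ifs <;> simp
  · have : {D : Data Δ N | ∀ i j, D i j ∈ B i j} = ⋂ i, ⋂ j, {D | D i j ∈ B i j} := by
      ext; simp
    rw [this]
    exact MeasurableSet.iInter fun i => MeasurableSet.iInter fun j =>
      measurableSet_preimage (by fun_prop) (hB i j)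

/-- The probability that the decision is appropriate for the `i`-th criterion. -/
noncomputable def reliability (P : Measure Δ) (Z : Fin m → Δ → Set 𝒵) (i : Fin m) (z : 𝒵) : ℝ :=
  P.real {δ | z ∈ Z i δ}

lemma reliability_nonneg (P : Measure Δ) (Z : Fin m → Δ → Set 𝒵) (i : Fin m) (z : 𝒵) :
    0 ≤ reliability P Z i z := measureReal_nonneg

lemma reliability_le_one (P : Measure Δ) [IsProbabilityMeasure P] (Z : Fin m → Δ → Set 𝒵)
    (i : Fin m) (z : 𝒵) : reliability P Z i z ≤ 1 := measureReal_le_one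

variable {Z : Fin m → Δ → Set 𝒵} {M : (Fin m → List Δ) → 𝒵}

/-- The assumption speaks of whole datasets of any size, so the selected scenarios are re-indexed
increasingly as datasets of sizes `(S i).card`. -/
lemma measurableSet_dec (hM : IsMeasurableScheme Z M) (hc : IsConsistentScheme Z M)
    (S : Selection N) (i : Fin m) :
    MeasurableSet {p : Data Δ N × Δ | dec M S p.1 ∈ Z i p.2} := by
  let e : ∀ i, Fin (S i).card ↪ Fin (N i) := fun i => ((S i).orderEmbOfFin rfl).toEmbedding
  have he : ∀ D : Data Δ N, dec M S D = M (toLists (restrict e D)) := by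
    intro D
    rw [← hc.dec_top, dec_restrict]
    congr 1
    ext1 l
    exact (Finset.map_orderEmbOfFin_univ (S l) rfl).symm
  have := hM (fun i => (S i).card) i
  have hmap : Measurable fun p : Data Δ N × Δ => (restrict e p.1, p.2) :=
    ((measurable_restrict e).comp measurable_fst).prodMk measurable_snd
  simp only [he]
  exact hmap this

lemma measurableSet_section (hM : IsMeasurableScheme Z M) (hc : IsConsistentScheme Z M)
    (S : Selection N) (i : Fin m) (D : Data Δ N) :
    MeasurableSet {δ | dec M S D ∈ Z i δ} :=
  measurable_prodMk_left (measurableSet_dec hM hc S i)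

lemma measurable_reliability (P : Measure Δ) [IsProbabilityMeasure P]
    (hM : IsMeasurableScheme Z M) (hc : IsConsistentScheme Z M)
    (S : Selection N) (i : Fin m) :
    Measurable fun D : Data Δ N => reliability P Z i (dec M S D) :=
  (measurable_measure_prodMk_left (measurableSet_dec hM hc S i)).ennreal_toReal

lemma measurableSet_dec_eq (hM : IsMeasurableScheme Z M) (hc : IsConsistentScheme Z M)
    {S T : Selection N} (hST : S ≤ T) :
    MeasurableSet {D : Data Δ N | dec M S D = dec M T D} := by
  have : {D : Data Δ N | dec M S D = dec M T D} =
      ⋂ i, ⋂ j ∈ T i \ S i, {D | dec M S D ∈ Z i (D i j)} := by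
    ext D
    simp [hc.dec_eq_iff hST]
  rw [this]
  refine MeasurableSet.iInter fun i => Finset.measurableSet_biInter _ fun j _ => ?_
  have hmap : Measurable fun D : Data Δ N => (D, D i j) := by fun_prop
  exact hmap (measurableSet_dec hM hc S i)

lemma measurableSet_isMinimal (hM : IsMeasurableScheme Z M) (hc : IsConsistentScheme Z M)
    (S : Selection N) : MeasurableSet {D : Data Δ N | IsMinimal M S D} := by
  have : {D : Data Δ N | IsMinimal M S D} =
      ⋂ i, ⋂ j ∈ S i, {D | dec M (del S i j) D = dec M S D}ᶜ := by
    ext D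
    simp [IsMinimal]
  rw [this]
  exact MeasurableSet.iInter fun i => Finset.measurableSet_biInter _ fun j _ =>
    (measurableSet_dec_eq hM hc (del_le S i j)).compl

/-- The datasets for which all the selected scenarios are support scenarios with respect to the
selection `S`, the reliabilities of the decision lie in `U`, and `T` gives the same decision. -/
def confirmedEvent (P : Measure Δ) (Z : Fin m → Δ → Set 𝒵) (M : (Fin m → List Δ) → 𝒵)
    (U : Set (Fin m → ℝ)) (S T : Selection N) : Set (Data Δ N) :=
  {D | IsMinimal M S D ∧ (fun i => reliability P Z i (dec M S D)) ∈ U ∧ dec M S D = dec M T D}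

lemma measurableSet_confirmedEvent (P : Measure Δ) [IsProbabilityMeasure P]
    (hM : IsMeasurableScheme Z M) (hc : IsConsistentScheme Z M) {U : Set (Fin m → ℝ)}
    (hU : MeasurableSet U) {S T : Selection N} (hST : S ≤ T) :
    MeasurableSet (confirmedEvent P Z M U S T) :=
  (measurableSet_isMinimal hM hc S).inter
    (((measurable_pi_lambda _ fun i => measurable_reliability P hM hc S i) hU).inter
      (measurableSet_dec_eq hM hc hST))

/-- Given the selected scenarios, the others confirm the decision independently. -/
lemma measureReal_confirmedEvent (P : Measure Δ) [IsProbabilityMeasure P]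
    (hM : IsMeasurableScheme Z M) (hc : IsConsistentScheme Z M) {S T : Selection N} (hST : S ≤ T)
    {U : Set (Fin m → ℝ)} (hU : MeasurableSet U) :
    (dataLaw P N).real (confirmedEvent P Z M U S T) =
    ∫ D in {D | IsMinimal M S D ∧ (fun i => reliability P Z i (dec M S D)) ∈ U},
      ∏ i, reliability P Z i (dec M S D) ^ ((T i).card - (S i).card) ∂(dataLaw P N) := by
  have hrel : Measurable fun D : Data Δ N => fun i => reliability P Z i (dec M S D) :=
    measurable_pi_lambda _ fun i => measurable_reliability P hM hc S i
  have hG : MeasurableSet {D : Data Δ N | IsMinimal M S D ∧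
      (fun i => reliability P Z i (dec M S D)) ∈ U} :=
    (measurableSet_isMinimal hM hc S).inter (hrel hU)
  have hE := measurableSet_confirmedEvent P hM hc hU hST
  rw [Measure.real, ← (measurePreserving_merge P S).measure_preimage hE.nullMeasurableSet,
    ← Measure.real, measureReal_def, Measure.prod_apply ((measurable_merge S) hE)]
  have hinner : ∀ x : Data Δ N, dataLaw P N (Prod.mk x ⁻¹'
      ((fun p : Data Δ N × Data Δ N => merge S p.1 p.2) ⁻¹' confirmedEvent P Z M U S T)) =
      {D : Data Δ N | IsMinimal M S D ∧
        (fun i => reliability P Z i (dec M S D)) ∈ U}.indicator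
        (fun D => ENNReal.ofReal
          (∏ i, reliability P Z i (dec M S D) ^ ((T i).card - (S i).card))) x := by
    intro x
    by_cases hx : x ∈ {D : Data Δ N | IsMinimal M S D ∧
        (fun i => reliability P Z i (dec M S D)) ∈ U}
    · rw [Set.indicator_of_mem hx]
      -- Minimality and reliabilities see only `x`; what remains for `y` is a box, with one
      -- constraint for each position of `T` outside `S`.
      have : Prod.mk x ⁻¹' ((fun p : Data Δ N × Data Δ N => merge S p.1 p.2) ⁻¹'
          confirmedEvent P Z M U S T) =
          {y | ∀ i j, y i j ∈ if j ∈ T i \ S i then {δ | dec M S x ∈ Z i δ} else Set.univ} := by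
        ext y
        simp only [confirmedEvent, Set.mem_preimage, Set.mem_ofPred_eq, isMinimal_merge, dec_merge M le_rfl,
          hx.1, hx.2, true_and, hc.dec_eq_iff hST]
        refine forall_congr' fun i => forall_congr' fun j => ?_
        by_cases hj : j ∈ T i \ S i
        · have := (Finset.mem_sdiff.1 hj).2
          simp [hj, merge, this]
        · simp only [hj, if_false, Set.mem_univ, IsEmpty.forall_iff]
      rw [this, dataLaw_box, ENNReal.ofReal_prod_of_nonneg
        fun i _ => pow_nonneg (reliability_nonneg P Z i _) _]
      refine Finset.prod_congr rfl fun i _ => ?_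
      rw [← Finset.card_sdiff_of_subset (hST i), ENNReal.ofReal_pow (reliability_nonneg P Z i _),
        reliability, ofReal_measureReal, ← Finset.prod_const,
        ← Finset.prod_subset (Finset.subset_univ (T i \ S i))]
      · exact Finset.prod_congr rfl fun j hj => by rw [if_pos hj]
      · intro j _ hj
        rw [if_neg hj]; simp
    · rw [Set.indicator_of_notMem hx]
      have : Prod.mk x ⁻¹' ((fun p : Data Δ N × Data Δ N => merge S p.1 p.2) ⁻¹'
          confirmedEvent P Z M U S T) = ∅ := by
        ext y
        simp only [confirmedEvent, Set.mem_preimage, Set.mem_ofPred_eq, isMinimal_merge, dec_merge M le_rfl,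
          Set.mem_empty_iff_false, iff_false]
        exact fun h => hx ⟨h.1, h.2.1⟩
      rw [this, measure_empty]
  simp_rw [hinner]
  rw [lintegral_indicator hG, integral_eq_lintegral_of_nonneg_ae]
  · exact Filter.Eventually.of_forall fun D => Finset.prod_nonneg
      fun i _ => pow_nonneg (reliability_nonneg P Z i _) _
  · exact (Finset.measurable_prod _ fun i _ =>
      (measurable_reliability P hM hc S i).pow_const _).aestronglyMeasurable

/-- The scenarios of `T` form i.i.d. datasets of sizes `(T i).card`, to which the almost sure
assumptions apply; nonempty lists are needed because these assumptions concern positive sizes only.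
-/
lemma ae_exists_isSupportSelection (P : Measure Δ) [IsProbabilityMeasure P]
    (hc : IsConsistentScheme Z M) (hnd : IsNonDegenerate P M) {K : ℕ}
    (hK : HasComplexityBound P M K) (T : Selection N) (hT : ∀ i, 1 ≤ (T i).card) :
    ∀ᵐ D ∂(dataLaw P N), ∃ S, IsSupportSelection M S T D ∧ ∑ i, (S i).card ≤ K := by
  let e : ∀ i, Fin (T i).card ↪ Fin (N i) := fun i => ((T i).orderEmbOfFin rfl).toEmbedding
  have hmp := measurePreserving_restrict P e
  filter_upwards [hmp.quasiMeasurePreserving.ae (hnd _ hT),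
    hmp.quasiMeasurePreserving.ae (hK _ hT)] with D h1 h2
  obtain ⟨S, hS, hcard⟩ := hc.exists_isSupportSelection_top h1
  refine ⟨fun i => (S i).map (e i), ?_, ?_⟩
  · have := hS.map e
    convert this using 1
    ext1 i
    exact (Finset.map_orderEmbOfFin_univ (T i) rfl).symm
  · simpa [hcard] using h2

end Law

/-! ### The zeros of ψ, and the comparison of the bounds. -/

section Bounds

/-- The function is continuous and strictly increasing on the positive half-line. At `b * c 1` the
term j = 1 alone cancels the 1, and at `B ≥ 1` every power is at most `B⁻¹`, so the sign changes in
between. -/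
lemma posZero_spec {b : ℝ} (hb : 0 < b) {J : ℕ} (hJ : 1 ≤ J) {c : ℕ → ℝ}
    (hc : ∀ j ∈ Finset.Icc 1 J, 0 ≤ c j) (hc1 : 0 < c 1) {f : ℝ → ℝ}
    (hf : ∀ t, f t = 1 - b * ∑ j ∈ Finset.Icc 1 J, c j * t ^ (-(j : ℤ))) :
    0 < posZero f ∧ (∀ t, 0 < t → (f t = 0 ↔ t = posZero f)) ∧
      ∀ t, 0 < t → (f t ≤ 0 ↔ t ≤ posZero f) := by
  have h1 : 1 ∈ Finset.Icc 1 J := Finset.mem_Icc.2 ⟨le_rfl, hJ⟩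
  have hmono : StrictMonoOn f (Set.Ioi 0) := by
    intro x hx y hy hxy
    have hx : 0 < x := hx
    have hy : 0 < y := hy
    rw [hf, hf]
    refine sub_lt_sub_left (mul_lt_mul_of_pos_left (Finset.sum_lt_sum (fun j hj => ?_)
      ⟨1, h1, ?_⟩) hb) 1
    · refine mul_le_mul_of_nonneg_left ?_ (hc j hj)
      rw [zpow_neg, zpow_neg, zpow_natCast, zpow_natCast]
      gcongr
    · refine mul_lt_mul_of_pos_left ?_ hc1
      rw [zpow_neg, zpow_neg, zpow_natCast, zpow_natCast]
      gcongr
  have hcont : ContinuousOn f (Set.Ioi 0) := by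
    have : f = fun t => 1 - b * ∑ j ∈ Finset.Icc 1 J, c j * t ^ (-(j : ℤ)) := funext hf
    rw [this]
    refine continuousOn_const.sub (continuousOn_const.mul (continuousOn_finsetSum _ fun j _ =>
      continuousOn_const.mul (ContinuousOn.zpow₀ continuousOn_id _ fun t ht =>
        Or.inl (ne_of_gt ht))))
  have hsum : c 1 ≤ ∑ j ∈ Finset.Icc 1 J, c j :=
    Finset.single_le_sum (f := c) hc h1
  have ha : 0 < b * c 1 := mul_pos hb hc1
  set B := max 1 (b * ∑ j ∈ Finset.Icc 1 J, c j) with hB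
  have hB1 : 1 ≤ B := le_max_left _ _
  have hBpos : 0 < B := one_pos.trans_le hB1
  have haB : b * c 1 ≤ B := (mul_le_mul_of_nonneg_left hsum hb.le).trans (le_max_right _ _)
  have hfa : f (b * c 1) ≤ 0 := by
    have : c 1 * (b * c 1) ^ (-((1 : ℕ) : ℤ)) ≤
        ∑ j ∈ Finset.Icc 1 J, c j * (b * c 1) ^ (-(j : ℤ)) :=
      Finset.single_le_sum (f := fun j : ℕ => c j * (b * c 1) ^ (-(j : ℤ)))
        (fun j hj => mul_nonneg (hc j hj) (zpow_nonneg ha.le _)) h1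
    have h2 := mul_le_mul_of_nonneg_left this hb.le
    have h3 : b * (c 1 * (b * c 1) ^ (-((1 : ℕ) : ℤ))) = 1 := by
      rw [Nat.cast_one, zpow_neg_one]
      field_simp
    rw [hf]
    linarith
  have hfB : 0 ≤ f B := by
    have h2 : ∑ j ∈ Finset.Icc 1 J, c j * B ^ (-(j : ℤ)) ≤
        (∑ j ∈ Finset.Icc 1 J, c j) * B⁻¹ := by
      rw [Finset.sum_mul]
      refine Finset.sum_le_sum fun j hj => mul_le_mul_of_nonneg_left ?_ (hc j hj)
      rw [← zpow_neg_one]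
      refine zpow_le_zpow_right₀ hB1 ?_
      have := (Finset.mem_Icc.1 hj).1
      omega
    have h3 := mul_le_mul_of_nonneg_left h2 hb.le
    have h4 : b * ((∑ j ∈ Finset.Icc 1 J, c j) * B⁻¹) ≤ 1 := by
      rw [← mul_assoc, ← div_eq_mul_inv]
      exact (div_le_one hBpos).2 (le_max_right _ _)
    rw [hf]
    linarith
  obtain ⟨r, hr, hr0⟩ := intermediate_value_Icc haB
    (hcont.mono fun t ht => ha.trans_le ht.1) ⟨hfa, hfB⟩
  have hrpos : 0 < r := ha.trans_le hr.1
  have hiff : ∀ t, 0 < t → (f t = 0 ↔ t = r) := fun t ht =>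
    ⟨fun h => hmono.injOn ht hrpos (h.trans hr0.symm), fun h => h ▸ hr0⟩
  have hzero : posZero f = r := by
    have : {t | 0 < t ∧ f t = 0} = {r} := by
      ext t
      exact ⟨fun h => (hiff t h.1).1 h.2, fun h => ⟨h ▸ hrpos, h ▸ hr0⟩⟩
    rw [posZero, this, csSup_singleton]
  rw [hzero]
  refine ⟨hrpos, hiff, fun t ht => ?_⟩
  rw [← hr0]
  exact hmono.le_iff_le ht hrpos

lemma posZero_nonneg (f : ℝ → ℝ) : 0 ≤ posZero f :=
  Real.sSup_nonneg fun _ h => h.1.le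

/-- The product form of `C(n-j,k) / C(n,k)`. -/
lemma choose_sub_div_choose {n j k : ℕ} (h : j + k ≤ n) :
    ((n - j).choose k : ℝ) / (n.choose k : ℝ) =
      ∏ l ∈ Finset.range k, (1 - (j : ℝ) / ((n : ℝ) - l)) := by
  induction k with
  | zero => simp
  | succ k ih =>
    rw [Finset.prod_range_succ, ← ih (by omega)]
    have h1 : ((n - j).choose (k + 1) : ℝ) * (k + 1) = (n - j).choose k * ((n : ℝ) - j - k) := by
      have := Nat.choose_succ_right_eq (n - j) k
      have h2 := congrArg (Nat.cast : ℕ → ℝ) this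
      push_cast [Nat.cast_sub (show k ≤ n - j by omega), Nat.cast_sub (show j ≤ n by omega)] at h2
      exact h2
    have h2 : (n.choose (k + 1) : ℝ) * (k + 1) = n.choose k * ((n : ℝ) - k) := by
      have := Nat.choose_succ_right_eq n k
      have h2 := congrArg (Nat.cast : ℕ → ℝ) this
      push_cast [Nat.cast_sub (show k ≤ n by omega)] at h2
      exact h2
    have hn : (0 : ℝ) < (n : ℝ) - k := by
      rw [sub_pos]; exact_mod_cast (by omega : k < n)
    have hk : (0 : ℝ) < k + 1 := by positivity
    have hc : (0 : ℝ) < n.choose k := by exact_mod_cast Nat.choose_pos (by omega)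
    have hc' : (0 : ℝ) < n.choose (k + 1) := by exact_mod_cast Nat.choose_pos (by omega)
    rw [one_sub_div hn.ne', div_mul_div_comm, ← h2, ← mul_div_mul_right _ _ hk.ne', h1]
    ring_nf

/-- Both sides are the probability that a j-subset and a k-subset of n points are disjoint. It turns
the coefficients of ψ into the fraction of deletions of j scenarios that avoid k given ones. -/
lemma choose_sub_div_choose_symm {n j k : ℕ} (hj : j ≤ n) (hk : k ≤ n) :
    ((n - k).choose j : ℝ) / (n.choose j : ℝ) = ((n - j).choose k : ℝ) / (n.choose k : ℝ) := by
  have h1 : n.choose k * (n - k).choose j = n.choose j * (n - j).choose k := by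
    have h2 := Nat.choose_mul (n := n) (Nat.le_add_left k j)
    have h3 := Nat.choose_mul (n := n) (Nat.le_add_right j k)
    rw [Nat.add_sub_cancel] at h2
    rw [Nat.add_sub_cancel_left] at h3
    rw [← h2, ← h3, Nat.choose_symm_add]
  have hc : (0 : ℝ) < n.choose k := by exact_mod_cast Nat.choose_pos hk
  have hc' : (0 : ℝ) < n.choose j := by exact_mod_cast Nat.choose_pos hj
  rw [div_eq_div_iff hc'.ne' hc.ne']
  have := congrArg (Nat.cast : ℕ → ℝ) h1
  push_cast at this
  linarith

lemma one_sub_div_nonneg {n j l : ℕ} (h : j + l < n) : 0 ≤ 1 - (j : ℝ) / ((n : ℝ) - l) := by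
  have h' : (j : ℝ) + l < n := by exact_mod_cast h
  have hj : (0 : ℝ) ≤ j := Nat.cast_nonneg j
  rw [sub_nonneg, div_le_one (by linarith)]
  linarith

lemma one_sub_div_le {n n' j l l' : ℕ} (h : j + l < n) (hn : n ≤ n') (hl : l' ≤ l) :
    1 - (j : ℝ) / ((n : ℝ) - l) ≤ 1 - (j : ℝ) / ((n' : ℝ) - l') := by
  have h' : (j : ℝ) + l < n := by exact_mod_cast h
  have hn' : (n : ℝ) ≤ n' := by exact_mod_cast hn
  have hl' : (l' : ℝ) ≤ l := by exact_mod_cast hl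
  have hj : (0 : ℝ) ≤ j := Nat.cast_nonneg j
  have : (0 : ℝ) < (n : ℝ) - l := by linarith
  gcongr

/-- The left side is the product of 1 - j/(n-l) over l < K. Cut this range into consecutive blocks
of lengths `k i`: each factor increases when its block is shifted back to start at l = 0 and when n
is replaced by `N i`. Leftover factors are at most 1. -/
lemma choose_ratio_le_prod {ι : Type*} (s : Finset ι) {n j K : ℕ} {k N : ι → ℕ}
    (hN : ∀ i ∈ s, n ≤ N i) (hk : ∑ i ∈ s, k i ≤ K) (hj : j + K ≤ n) :
    ((n - j).choose K : ℝ) / (n.choose K : ℝ) ≤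
      ∏ i ∈ s, ((N i - j).choose (k i) : ℝ) / ((N i).choose (k i) : ℝ) := by
  classical
  induction s using Finset.induction_on generalizing K with
  | empty =>
    rw [Finset.prod_empty]
    refine div_le_one_of_le₀ ?_ (Nat.cast_nonneg _)
    exact_mod_cast Nat.choose_le_choose K (Nat.sub_le n j)
  | insert a s ha ih =>
    rw [Finset.sum_insert ha] at hk
    obtain ⟨b, rfl⟩ := Nat.exists_eq_add_of_le (le_of_add_le_left hk)
    rw [Finset.prod_insert ha]
    have hs := ih (K := b) (fun i hi => hN i (Finset.mem_insert_of_mem hi)) (by omega) (by omega)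
    refine le_trans ?_ (mul_le_mul_of_nonneg_left hs (by positivity))
    have hNa := hN a (Finset.mem_insert_self a s)
    rw [choose_sub_div_choose hj, choose_sub_div_choose (by omega : j + b ≤ n),
      choose_sub_div_choose (by omega : j + k a ≤ N a), Finset.prod_range_add]
    refine mul_le_mul ?_ ?_ ?_ ?_
    · refine Finset.prod_le_prod (fun l hl => ?_) fun l hl => ?_
      · have := Finset.mem_range.1 hl
        exact one_sub_div_nonneg (by omega)
      · have := Finset.mem_range.1 hl
        exact one_sub_div_le (by omega) hNa le_rfl
    · refine Finset.prod_le_prod (fun l hl => ?_) fun l hl => ?_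
      · have := Finset.mem_range.1 hl
        exact one_sub_div_nonneg (by omega)
      · have := Finset.mem_range.1 hl
        exact one_sub_div_le (by omega) le_rfl (by omega)
    · refine Finset.prod_nonneg fun l hl => ?_
      have := Finset.mem_range.1 hl
      exact one_sub_div_nonneg (by omega)
    · refine Finset.prod_nonneg fun l hl => ?_
      have := Finset.mem_range.1 hl
      exact one_sub_div_nonneg (by omega)

lemma tLow_spec {β : ℝ} (hβ : 0 < β) {K n : ℕ} (hKn : K < n) :
    0 < tLow β K n ∧ (∀ t, 0 < t → (psi β K n t = 0 ↔ t = tLow β K n)) ∧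
      ∀ t, 0 < t → (psi β K n t ≤ 0 ↔ t ≤ tLow β K n) := by
  rw [tLow, if_pos hKn]
  refine posZero_spec (b := β / n) (J := n - K)
    (c := fun j => ((n - j).choose K : ℝ) / (n.choose K : ℝ)) ?_ (by omega) ?_ ?_ fun t => rfl
  · have : (0 : ℝ) < n := by exact_mod_cast (by omega : 0 < n)
    positivity
  · intro j _
    positivity
  · have h1 : 0 < (n - 1).choose K := Nat.choose_pos (by omega)
    have h2 : 0 < n.choose K := Nat.choose_pos (by omega)
    positivity

lemma tLow_nonneg (β : ℝ) (K n : ℕ) : 0 ≤ tLow β K n := by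
  rw [tLow]
  split_ifs
  · exact posZero_nonneg _
  · exact le_rfl

/-- At t = 1 the sum has at most n terms, each at most 1, so ψ(1) ≥ 1 - β > 0. -/
lemma tLow_lt_one {β : ℝ} (hβ : β ∈ Set.Ioo (0 : ℝ) 1) {K n : ℕ} (hKn : K < n) :
    tLow β K n < 1 := by
  have hn : (0 : ℝ) < n := by exact_mod_cast (by omega : 0 < n)
  by_contra! hle
  have h1 := ((tLow_spec hβ.1 hKn).2.2 1 one_pos).2 hle
  have h2 : ∑ j ∈ Finset.Icc 1 (n - K), ((n - j).choose K : ℝ) / (n.choose K : ℝ) *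
      (1 : ℝ) ^ (-(j : ℤ)) ≤ n := by
    calc _ ≤ ∑ j ∈ Finset.Icc 1 (n - K), (1 : ℝ) := by
          refine Finset.sum_le_sum fun j _ => ?_
          rw [one_zpow, mul_one]
          refine div_le_one_of_le₀ ?_ (Nat.cast_nonneg _)
          exact_mod_cast Nat.choose_le_choose K (Nat.sub_le n j)
      _ ≤ n := by
          rw [Finset.sum_const, Nat.card_Icc, nsmul_eq_mul, mul_one]
          exact_mod_cast (by omega : n - K + 1 - 1 ≤ n)
  have h3 := mul_le_mul_of_nonneg_left h2 (div_nonneg hβ.1.le hn.le)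
  rw [div_mul_cancel₀ _ hn.ne'] at h3
  rw [psi] at h1
  linarith [hβ.2]

lemma epsOf_le_epsOf {m : ℕ} {s t : ℝ} (hs : 0 ≤ s) (hst : s ≤ t) : epsOf m t ≤ epsOf m s := by
  unfold epsOf
  gcongr

lemma epsOf_zero {m : ℕ} (hm : 1 ≤ m) : epsOf m 0 = 1 := by
  have : (1 : ℝ) ≤ m := by exact_mod_cast hm
  rw [epsOf, Real.zero_rpow (by positivity)]
  simpa using this

lemma tVec_spec {m : ℕ} (hm : 1 ≤ m) {β : ℝ} (hβ : 0 < β) {k N : Fin m → ℕ}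
    (hk : ∀ i, k i < N i) :
    ∀ t, 0 < t → (psiVec β k N t ≤ 0 ↔ t ≤ tVec β k N) := by
  have : Nonempty (Fin m) := ⟨⟨0, hm⟩⟩
  have hN : 1 ≤ ⨅ i, N i := le_ciInf fun i => by have := hk i; omega
  rw [tVec, if_pos hk]
  refine (posZero_spec (b := β / ((⨅ i, N i : ℕ) : ℝ)) (J := ⨅ i, (N i - k i))
    (c := fun j => ∏ i, ((N i - j).choose (k i) : ℝ) / ((N i).choose (k i) : ℝ))
    ?_ ?_ ?_ ?_ fun t => rfl).2.2
  · have : (0 : ℝ) < (⨅ i, N i : ℕ) := by exact_mod_cast hN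
    positivity
  · exact le_ciInf fun i => by have := hk i; omega
  · intro j _
    exact Finset.prod_nonneg fun i _ => by positivity
  · refine Finset.prod_pos fun i _ => ?_
    have := hk i
    have h1 : 0 < (N i - 1).choose (k i) := Nat.choose_pos (by omega)
    have h2 : 0 < (N i).choose (k i) := Nat.choose_pos (by omega)
    positivity

lemma tVec_nonneg {m : ℕ} (β : ℝ) (k N : Fin m → ℕ) : 0 ≤ tVec β k N := by
  rw [tVec]
  split_ifs
  · exact posZero_nonneg _
  · exact le_rfl

lemma psiVec_le_psi {m : ℕ} (hm : 1 ≤ m) {β : ℝ} (hβ : 0 < β) {k N : Fin m → ℕ} {K : ℕ}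
    (hk : ∑ i, k i ≤ K) {t : ℝ} (ht : 0 < t) :
    psiVec β k N t ≤ psi β K (⨅ i, N i) t := by
  have : Nonempty (Fin m) := ⟨⟨0, hm⟩⟩
  have hle : ∀ i, (⨅ i, N i) ≤ N i := fun i => ciInf_le (OrderBot.bddBelow _) i
  have hkK : ∀ i, k i ≤ K := fun i =>
    (Finset.single_le_sum (f := k) (fun _ _ => Nat.zero_le _) (Finset.mem_univ i)).trans hk
  unfold psiVec psi
  refine sub_le_sub_left (mul_le_mul_of_nonneg_left ?_ (by positivity)) 1
  calc _ ≤ ∑ j ∈ Finset.Icc 1 ((⨅ i, N i) - K),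
        (∏ i, ((N i - j).choose (k i) : ℝ) / ((N i).choose (k i) : ℝ)) * t ^ (-(j : ℤ)) := by
        refine Finset.sum_le_sum fun j hj => ?_
        have := Finset.mem_Icc.1 hj
        exact mul_le_mul_of_nonneg_right
          (choose_ratio_le_prod _ (fun i _ => hle i) hk (by omega)) (zpow_nonneg ht.le _)
    _ ≤ _ := by
        refine Finset.sum_le_sum_of_subset_of_nonneg (Finset.Icc_subset_Icc_right ?_) ?_
        · exact le_ciInf fun i => by
            have := hle i
            have := hkK i
            omega
        · intro j _ _
          exact mul_nonneg (Finset.prod_nonneg fun i _ => by positivity) (zpow_nonneg ht.le _)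

lemma epsPosteriori_le_epsApriori {m : ℕ} (hm : 1 ≤ m) {β : ℝ} (hβ : 0 < β)
    {k N : Fin m → ℕ} {K : ℕ} (hk : ∑ i, k i ≤ K) :
    epsPosteriori β k N ≤ epsApriori m β K (⨅ i, N i) := by
  refine epsOf_le_epsOf (tLow_nonneg _ _ _) ?_
  by_cases hKn : K < ⨅ i, N i
  · have hspec := tLow_spec hβ hKn
    have hlt : ∀ i, k i < N i := fun i =>
      ((Finset.single_le_sum (f := k) (fun _ _ => Nat.zero_le _) (Finset.mem_univ i)).trans
        hk).trans_lt (hKn.trans_le (ciInf_le (OrderBot.bddBelow _) i))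
    rw [← tVec_spec hm hβ hlt _ hspec.1]
    exact (psiVec_le_psi hm hβ hk hspec.1).trans ((hspec.2.1 _ hspec.1).2 rfl).le
  · rw [tLow, if_neg hKn]
    exact tVec_nonneg _ _ _

lemma psiVec_single {m : ℕ} (β : ℝ) (K n : ℕ) (i : Fin m) :
    psiVec β (Pi.single i K) (fun _ : Fin m => n) = psi β K n := by
  have : Nonempty (Fin m) := ⟨i⟩
  have hinf : (⨅ l : Fin m, (n - (Pi.single i K : Fin m → ℕ) l)) = n - K := by
    refine le_antisymm ((ciInf_le (OrderBot.bddBelow _) i).trans (by simp)) (le_ciInf fun l => ?_)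
    rcases eq_or_ne l i with rfl | hl
    · simp
    · simp [hl]
  ext t
  rw [psiVec, psi, hinf, ciInf_const]
  congr 2
  refine Finset.sum_congr rfl fun j _ => ?_
  congr 1
  rw [Finset.prod_eq_single i]
  · simp
  · intro l _ hl
    simp [hl]
  · simp

lemma epsPosteriori_single {m : ℕ} (β : ℝ) (K : ℕ) {n : ℕ} (hn : 1 ≤ n) (i : Fin m) :
    epsPosteriori β (Pi.single i K) (fun _ : Fin m => n) = epsApriori m β K n := by
  have hiff : (∀ l, (Pi.single i K : Fin m → ℕ) l < n) ↔ K < n := by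
    refine ⟨fun h => by simpa using h i, fun h l => ?_⟩
    rcases eq_or_ne l i with rfl | hl
    · simpa using h
    -- The other components are 0, and 0 < n is where positive size enters; it matters when m > 1.
    · simpa [hl] using Nat.pos_of_ne_zero (by omega : n ≠ 0)
  rw [epsPosteriori, epsApriori, tVec, tLow, psiVec_single]
  simp only [hiff]

/-- The arithmetic-geometric mean inequality, in terms of violation probabilities. -/
lemma sum_one_sub_le {m : ℕ} (hm : 1 ≤ m) {q : Fin m → ℝ} (hq : ∀ i, 0 ≤ q i) {t : ℝ}
    (ht : 0 ≤ t) (htq : t ≤ ∏ i, q i) :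
    ∑ i, (1 - q i) ≤ m * (1 - t ^ ((1 : ℝ) / m)) := by
  have hm' : (0 : ℝ) < m := by exact_mod_cast hm
  have h1 := Real.geom_mean_le_arith_mean_weighted Finset.univ (fun _ : Fin m => (1 : ℝ) / m) q
    (fun _ _ => by positivity) (by simp [hm'.ne']) (fun i _ => hq i)
  have h2 : t ^ ((1 : ℝ) / m) ≤ ∏ i, q i ^ ((1 : ℝ) / m) := by
    rw [Real.finsetProd_rpow _ _ fun i _ => hq i]
    exact Real.rpow_le_rpow ht htq (by positivity)
  rw [← Finset.mul_sum] at h1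
  have h3 := h2.trans h1
  rw [one_div_mul_eq_div, le_div_iff₀ hm'] at h3
  rw [Finset.sum_sub_distrib, Finset.sum_const, Finset.card_univ, Fintype.card_fin, nsmul_eq_mul,
    mul_one]
  linarith

end Bounds

/-! ### Summing over selections: the bound on the risk. -/

section Risk

lemma prod_pow_le_of_prod_lt_tLow {m : ℕ} {β : ℝ} (hβ : 0 < β) {K n : ℕ} (hKn : K < n)
    {k N : Fin m → ℕ} (hN : ∀ i, n ≤ N i) (hk : ∑ i, k i ≤ K) {q : Fin m → ℝ}
    (hq : ∀ i, 0 ≤ q i) (hqt : ∏ i, q i < tLow β K n) :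
    ∏ i, q i ^ (N i - k i) ≤ β / n * ∑ j ∈ Finset.Icc 1 (n - K),
      (∏ i, ((N i - k i).choose j : ℝ) / ((N i).choose j : ℝ)) *
        ∏ i, q i ^ (N i - j - k i) := by
  have hkK : ∀ i, k i ≤ K := fun i =>
    (Finset.single_le_sum (f := k) (fun _ _ => Nat.zero_le _) (Finset.mem_univ i)).trans hk
  -- A vanishing product cannot be inserted in ψ; then some `q i` is 0 with the positive exponent `N
  -- i - k i`, and the left side vanishes.
  rcases (Finset.prod_nonneg fun i _ => hq i : 0 ≤ ∏ i, q i).eq_or_lt with h0 | hpos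
  · obtain ⟨i, _, hi⟩ := Finset.prod_eq_zero_iff.1 h0.symm
    rw [Finset.prod_eq_zero (Finset.mem_univ i)]
    · refine mul_nonneg (by positivity) (Finset.sum_nonneg fun j _ => mul_nonneg ?_ ?_)
      · exact Finset.prod_nonneg fun i _ => by positivity
      · exact Finset.prod_nonneg fun i _ => pow_nonneg (hq i) _
    · have := hkK i
      have := hN i
      rw [hi, zero_pow (by omega)]
  · have hq' : ∀ i, q i ≠ 0 := fun i => Finset.prod_ne_zero_iff.1 hpos.ne' i (Finset.mem_univ i)
    have h1 := ((tLow_spec hβ hKn).2.2 _ hpos).2 hqt.le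
    have hW : 0 ≤ ∏ i, q i ^ (N i - k i) := Finset.prod_nonneg fun i _ => pow_nonneg (hq i) _
    rw [psi, sub_nonpos] at h1
    refine (le_mul_of_one_le_left hW h1).trans ?_
    rw [mul_assoc, Finset.sum_mul]
    refine mul_le_mul_of_nonneg_left (Finset.sum_le_sum fun j hj => ?_) (by positivity)
    have hj := Finset.mem_Icc.1 hj
    have h2 : (∏ i, q i) ^ (-(j : ℤ)) * ∏ i, q i ^ (N i - k i) =
        ∏ i, q i ^ (N i - j - k i) := by
      rw [zpow_neg, zpow_natCast, ← Finset.prod_pow, inv_mul_eq_div, ← Finset.prod_div_distrib]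
      refine Finset.prod_congr rfl fun i _ => ?_
      have := hkK i
      have := hN i
      rw [div_eq_iff (pow_ne_zero _ (hq' i)), ← pow_add]
      congr 1
      omega
    rw [mul_assoc, h2]
    refine mul_le_mul_of_nonneg_right ?_
      (Finset.prod_nonneg fun i _ => pow_nonneg (hq i) _)
    refine (choose_ratio_le_prod _ (fun i _ => hN i) hk (by omega)).trans_eq
      (Finset.prod_congr rfl fun i _ => ?_)
    have := hkK i
    have := hN i
    rw [choose_sub_div_choose_symm (by omega) (by omega)]

variable {m : ℕ} {Δ 𝒵 : Type*} [MeasurableSpace Δ] {N : Fin m → ℕ}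
  {Z : Fin m → Δ → Set 𝒵} {M : (Fin m → List Δ) → 𝒵}

/-- The selections of at most `K` scenarios. -/
def smallSelections (N : Fin m → ℕ) (K : ℕ) : Finset (Selection N) :=
  Finset.univ.filter fun S => ∑ i, (S i).card ≤ K

/-- The selections of `j` scenarios from each dataset. -/
def levelSelections (N : Fin m → ℕ) (j : ℕ) : Finset (Selection N) :=
  Fintype.piFinset fun _ => Finset.univ.powersetCard j

lemma mem_levelSelections {j : ℕ} {V : Selection N} :
    V ∈ levelSelections N j ↔ ∀ i, (V i).card = j := by
  simp [levelSelections, Finset.mem_powersetCard]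

lemma card_levelSelections (N : Fin m → ℕ) (j : ℕ) :
    (levelSelections N j).card = ∏ i, (N i).choose j := by
  simp [levelSelections]

open Classical in
lemma card_levelSelections_filter (S : Selection N) (j : ℕ) :
    ((levelSelections N j).filter fun V => S ≤ Vᶜ).card =
      ∏ i, (N i - (S i).card).choose j := by
  have : (levelSelections N j).filter (fun V => S ≤ Vᶜ) =
      Fintype.piFinset fun i => (S i)ᶜ.powersetCard j := by
    ext V
    simp only [Finset.mem_filter, mem_levelSelections, Fintype.mem_piFinset,
      Finset.mem_powersetCard, le_compl_comm (a := S), Pi.le_def, Pi.compl_apply,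
      forall_and, and_comm]
  rw [this]
  simp [Finset.card_compl]

open Classical in
lemma sum_measureReal_confirmedEvent_le_one (P : Measure Δ) [IsProbabilityMeasure P]
    (hM : IsMeasurableScheme Z M) (hc : IsConsistentScheme Z M) (hnd : IsNonDegenerate P M)
    {K : ℕ} (hK : HasComplexityBound P M K) {U : Set (Fin m → ℝ)} (hU : MeasurableSet U)
    {T : Selection N} (hT : ∀ i, K ≤ (T i).card) :
    ∑ S ∈ (smallSelections N K).filter (· ≤ T),
      (dataLaw P N).real (confirmedEvent P Z M U S T) ≤ 1 := by
  rcases K.eq_zero_or_pos with rfl | hKpos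
  -- For K = 0 a list of `T` may be empty, where non-degeneracy is not assumed; but the empty
  -- selection is then the only possible term.
  · have hsub : (smallSelections N 0).filter (· ≤ T) ⊆ {⊥} := by
      intro S hS
      have := (Finset.mem_filter.1 (Finset.mem_filter.1 hS).1).2
      rw [Finset.mem_singleton]
      ext1 i
      simpa using Finset.sum_eq_zero_iff.1 (Nat.le_zero.1 this) i (Finset.mem_univ i)
    calc _ ≤ ∑ S ∈ ({⊥} : Finset (Selection N)),
          (dataLaw P N).real (confirmedEvent P Z M U S T) :=
          Finset.sum_le_sum_of_subset_of_nonneg hsub fun _ _ _ => measureReal_nonneg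
      _ ≤ 1 := by
          rw [Finset.sum_singleton]
          exact measureReal_le_one
  · rw [← measureReal_biUnion_finset₀]
    · exact measureReal_le_one
    -- Almost sure disjointness: on both events `S` and `S'` would equal the unique support
    -- selection of `T`.
    · intro S hS S' hS' hne
      have hS := (Finset.mem_filter.1 hS).2
      have hS' := (Finset.mem_filter.1 hS').2
      refine measure_eq_zero_iff_ae_notMem.2 ?_
      filter_upwards [ae_exists_isSupportSelection P hc hnd hK T
        fun i => hKpos.trans_le (hT i)] with D hD hmem
      obtain ⟨S₀, hS₀, -⟩ := hD
      exact hne ((hS₀.eq_of_isMinimal hc hS hmem.1.1 hmem.1.2.2).trans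
        (hS₀.eq_of_isMinimal hc hS' hmem.2.1 hmem.2.2.2).symm)
    · intro S hS
      exact (measurableSet_confirmedEvent P hM hc hU
        (Finset.mem_filter.1 hS).2).nullMeasurableSet

lemma integrable_prod_reliability_pow (P : Measure Δ) [IsProbabilityMeasure P]
    (hM : IsMeasurableScheme Z M) (hc : IsConsistentScheme Z M) (S : Selection N)
    (r : Fin m → ℕ) :
    Integrable (fun D => ∏ i, reliability P Z i (dec M S D) ^ r i) (dataLaw P N) := by
  refine Integrable.of_bound (Finset.measurable_prod _ fun i _ =>
    (measurable_reliability P hM hc S i).pow_const _).aestronglyMeasurable 1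
    (Filter.Eventually.of_forall fun D => ?_)
  have h0 : ∀ i, 0 ≤ reliability P Z i (dec M S D) ^ r i := fun i =>
    pow_nonneg (reliability_nonneg P Z i _) _
  rw [Real.norm_of_nonneg (Finset.prod_nonneg fun i _ => h0 i)]
  exact Finset.prod_le_one (fun i _ => h0 i) fun i _ =>
    pow_le_one₀ (reliability_nonneg P Z i _) (reliability_le_one P Z i _)

/-- The decision based on all the scenarios is unlikely to have a small product of reliabilities. -/
lemma measureReal_prod_reliability_lt_le (hm : 1 ≤ m) (P : Measure Δ) [IsProbabilityMeasure P]
    (hM : IsMeasurableScheme Z M) (hc : IsConsistentScheme Z M) (hnd : IsNonDegenerate P M)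
    {K : ℕ} (hK : HasComplexityBound P M K) {β : ℝ} (hβ : 0 < β) (hKN : K < ⨅ i, N i) :
    (dataLaw P N).real {D | ∏ i, reliability P Z i (dec M ⊤ D) < tLow β K (⨅ i, N i)} ≤ β := by
  classical
  have : Nonempty (Fin m) := ⟨⟨0, hm⟩⟩
  set n := ⨅ i, N i with hn
  have hnN : ∀ i, n ≤ N i := fun i => ciInf_le (OrderBot.bddBelow _) i
  set μ := dataLaw P N with hμ
  set U : Set (Fin m → ℝ) := {q | ∏ i, q i < tLow β K n} with hUdef
  have hU : MeasurableSet U := measurableSet_lt (by fun_prop) measurable_const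
  set I : Selection N → ℕ → ℝ := fun S j =>
    ∫ D in {D | IsMinimal M S D ∧ (fun i => reliability P Z i (dec M S D)) ∈ U},
      ∏ i, reliability P Z i (dec M S D) ^ (N i - j - (S i).card) ∂μ with hI
  have hcard : ∀ {j : ℕ} {V : Selection N}, V ∈ levelSelections N j → ∀ i,
      ((Vᶜ : Selection N) i).card = N i - j := by
    intro j V hV i
    rw [Pi.compl_apply, Finset.card_compl, mem_levelSelections.1 hV i, Fintype.card_fin]
  have hlevel : ∀ {j : ℕ} {V S : Selection N}, V ∈ levelSelections N j → S ≤ Vᶜ →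
      μ.real (confirmedEvent P Z M U S Vᶜ) = I S j := by
    intro j V S hV hS
    rw [hμ, measureReal_confirmedEvent P hM hc hS hU]
    simp only [hcard hV, hI, hμ]
  have hupper : μ.real {D | ∏ i, reliability P Z i (dec M ⊤ D) < tLow β K n} ≤
      ∑ S ∈ smallSelections N K, μ.real (confirmedEvent P Z M U S ⊤) := by
    refine le_trans ?_ (measureReal_biUnion_finset_le _ _)
    refine ENNReal.toReal_mono (measure_ne_top _ _) (measure_mono_ae ?_)
    filter_upwards [ae_exists_isSupportSelection P hc hnd hK (⊤ : Selection N) fun i => by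
      have := hnN i
      simp only [Pi.top_apply, Finset.top_eq_univ, Finset.card_univ, Fintype.card_fin]
      omega] with D hD hlt
    obtain ⟨S, hS, hSK⟩ := hD
    refine Set.mem_biUnion (x := S) (by simpa [smallSelections] using hSK) ?_
    refine ⟨hS.isMinimal hc, ?_, hS.dec_eq⟩
    rw [hS.dec_eq]
    exact hlt
  have hpoint : ∀ S ∈ smallSelections N K, μ.real (confirmedEvent P Z M U S ⊤) ≤
      β / n * ∑ j ∈ Finset.Icc 1 (n - K),
        (∏ i, ((N i - (S i).card).choose j : ℝ) / ((N i).choose j : ℝ)) * I S j := by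
    intro S hS
    have hSK : ∑ i, (S i).card ≤ K := (Finset.mem_filter.1 hS).2
    rw [hμ, measureReal_confirmedEvent P hM hc le_top hU]
    have hint := integrable_prod_reliability_pow P hM hc S
    calc _ ≤ ∫ D in {D | IsMinimal M S D ∧ (fun i => reliability P Z i (dec M S D)) ∈ U},
          β / n * ∑ j ∈ Finset.Icc 1 (n - K),
            (∏ i, ((N i - (S i).card).choose j : ℝ) / ((N i).choose j : ℝ)) *
              ∏ i, reliability P Z i (dec M S D) ^ (N i - j - (S i).card) ∂μ := by
          refine setIntegral_mono_on (hint _).integrableOn ?_ ?_ ?_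
          · exact Integrable.integrableOn (Integrable.const_mul
              (integrable_finsetSum _ fun j _ => (hint _).const_mul _) _)
          · exact (measurableSet_isMinimal hM hc S).inter
              ((measurable_pi_lambda _ fun i => measurable_reliability P hM hc S i) hU)
          · intro D hD
            simp only [Pi.top_apply, Finset.top_eq_univ, Finset.card_univ, Fintype.card_fin]
            exact prod_pow_le_of_prod_lt_tLow hβ hKN hnN hSK
              (fun i => reliability_nonneg P Z i _) hD.2
      _ = _ := by
          rw [integral_const_mul, integral_finsetSum _ fun j _ =>
            ((hint _).const_mul _).integrableOn]
          simp only [integral_const_mul, hI, hμ]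
  have hswap : ∀ j ∈ Finset.Icc 1 (n - K), ∑ S ∈ smallSelections N K,
      (∏ i, ((N i - (S i).card).choose j : ℝ) / ((N i).choose j : ℝ)) * I S j ≤ 1 := by
    intro j hj
    have hj := Finset.mem_Icc.1 hj
    have hpos : (0 : ℝ) < ∏ i, ((N i).choose j : ℝ) := Finset.prod_pos fun i _ => by
      have := hnN i
      exact_mod_cast Nat.choose_pos (by omega)
    -- The product counts the deletions `V` that avoid `S`. All of them give the same probability `I
    -- S j`, so the sums over `S` and `V` can be exchanged and the bound 1 used for each `V`.
    have h1 : ∀ S : Selection N, (∏ i, ((N i - (S i).card).choose j : ℝ)) * I S j =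
        ∑ V ∈ levelSelections N j, if S ≤ Vᶜ then
          μ.real (confirmedEvent P Z M U S Vᶜ) else 0 := by
      intro S
      rw [← Finset.sum_filter, Finset.sum_congr rfl fun V hV =>
        hlevel (Finset.mem_filter.1 hV).1 (Finset.mem_filter.1 hV).2, Finset.sum_const,
        card_levelSelections_filter, nsmul_eq_mul, Nat.cast_prod]
    have h2 : ∑ S ∈ smallSelections N K, (∏ i, ((N i - (S i).card).choose j : ℝ)) * I S j ≤
        ∏ i, ((N i).choose j : ℝ) := by
      simp_rw [h1]
      rw [Finset.sum_comm, ← Nat.cast_prod, ← card_levelSelections, ← nsmul_one]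
      refine Finset.sum_le_card_nsmul _ _ _ fun V hV => ?_
      rw [← Finset.sum_filter]
      refine sum_measureReal_confirmedEvent_le_one P hM hc hnd hK hU fun i => ?_
      have := hnN i
      rw [hcard hV]
      omega
    simp_rw [Finset.prod_div_distrib, div_mul_eq_mul_div]
    rw [← Finset.sum_div]
    exact (div_le_one hpos).2 h2
  have hnpos : (0 : ℝ) < n := by exact_mod_cast (by omega : 0 < n)
  calc _ ≤ ∑ S ∈ smallSelections N K, β / n * ∑ j ∈ Finset.Icc 1 (n - K),
        (∏ i, ((N i - (S i).card).choose j : ℝ) / ((N i).choose j : ℝ)) * I S j :=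
        hupper.trans (Finset.sum_le_sum hpoint)
    _ = β / n * ∑ j ∈ Finset.Icc 1 (n - K), ∑ S ∈ smallSelections N K,
        (∏ i, ((N i - (S i).card).choose j : ℝ) / ((N i).choose j : ℝ)) * I S j := by
        rw [← Finset.mul_sum, Finset.sum_comm]
    _ ≤ β / n * ∑ j ∈ Finset.Icc 1 (n - K), (1 : ℝ) := by
        gcongr with j hj
        exact hswap j hj
    _ ≤ β / n * n := by
        rw [Finset.sum_const, Nat.card_Icc, nsmul_eq_mul, mul_one]
        gcongr
        omega
    _ = β := div_mul_cancel₀ _ hnpos.ne'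

lemma jointRisk_dec_le (hm : 1 ≤ m) (P : Measure Δ) [IsProbabilityMeasure P]
    (hM : IsMeasurableScheme Z M) (hc : IsConsistentScheme Z M) (S : Selection N) (D : Data Δ N)
    {t : ℝ} (ht : 0 ≤ t) (htq : t ≤ ∏ i, reliability P Z i (dec M S D)) :
    jointRisk P Z (dec M S D) ≤ epsOf m t := by
  refine le_min ?_ measureReal_le_one
  refine le_trans ?_ (sum_one_sub_le hm (fun i => reliability_nonneg P Z i _) ht htq)
  have : {δ | ∃ i, dec M S D ∉ Z i δ} = ⋃ i, {δ | dec M S D ∈ Z i δ}ᶜ := by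
    ext; simp
  rw [jointRisk, this]
  refine (measureReal_iUnion_fintype_le _).trans_eq (Finset.sum_congr rfl fun i _ => ?_)
  rw [probReal_compl_eq_one_sub (measurableSet_section hM hc S i D), reliability]

lemma one_sub_le_measureReal_jointRisk_le (hm : 1 ≤ m) (P : Measure Δ) [IsProbabilityMeasure P]
    (hM : IsMeasurableScheme Z M) (hc : IsConsistentScheme Z M) (hnd : IsNonDegenerate P M)
    {K : ℕ} (hK : HasComplexityBound P M K) {β : ℝ} (hβ : 0 < β) :
    1 - β ≤ (dataLaw P N).real
      {D | jointRisk P Z (M (toLists D)) ≤ epsApriori m β K (⨅ i, N i)} := by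
  by_cases hKN : K < ⨅ i, N i
  · have hmeas : MeasurableSet
        {D : Data Δ N | ∏ i, reliability P Z i (dec M ⊤ D) < tLow β K (⨅ i, N i)} :=
      measurableSet_lt (Finset.measurable_prod _ fun i _ =>
        measurable_reliability P hM hc ⊤ i) measurable_const
    have h1 := measureReal_prod_reliability_lt_le hm P hM hc hnd hK hβ hKN
    have h2 := probReal_compl_eq_one_sub (μ := dataLaw P N) hmeas
    refine le_trans (by linarith) (measureReal_mono (s₁ := {D : Data Δ N |
      ∏ i, reliability P Z i (dec M ⊤ D) < tLow β K (⨅ i, N i)}ᶜ) fun D hD => ?_)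
    have := jointRisk_dec_le hm P hM hc ⊤ D (tLow_nonneg β K _) (not_lt.1 hD)
    rwa [hc.dec_top] at this
  · have : {D : Data Δ N | jointRisk P Z (M (toLists D)) ≤ epsApriori m β K (⨅ i, N i)} =
        Set.univ := by
      refine Set.eq_univ_of_forall fun D => ?_
      rw [Set.mem_ofPred_eq, epsApriori, tLow, if_neg hKN, epsOf_zero hm]
      exact measureReal_le_one
    rw [this, probReal_univ]
    linarith

end Risk

end ScenarioApproach

theorem proposition3 {m : ℕ} (hm : 1 ≤ m) {Δ 𝒵 : Type*} [MeasurableSpace Δ]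
    (P : Measure Δ) [IsProbabilityMeasure P]
    (Z : Fin m → Δ → Set 𝒵) (M : (Fin m → List Δ) → 𝒵)
    (hmeas : IsMeasurableScheme Z M)
    (hcons : IsConsistentScheme Z M)
    (hnd : IsNonDegenerate P M)
    (K : ℕ) (hK : HasComplexityBound P M K)
    (N : Fin m → ℕ) (hN : ∀ i, 1 ≤ N i)
    (β : ℝ) (hβ : β ∈ Set.Ioo (0 : ℝ) 1) :
    -- the bound on the joint risk
    1 - β ≤ (dataLaw P N).real
        {D | jointRisk P Z (M (toLists D)) ≤ epsApriori m β K (⨅ i, N i)} ∧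
    -- `t_K` is well defined: it is the only positive zero, and it lies in `(0, 1)`
    (K < (⨅ i, N i) →
      tLow β K (⨅ i, N i) ∈ Set.Ioo (0 : ℝ) 1 ∧
      ∀ t : ℝ, 0 < t → (psi β K (⨅ i, N i) t = 0 ↔ t = tLow β K (⨅ i, N i))) ∧
    -- it is a worst case over all the complexities whose total is at most `K` …
    (∀ k : Fin m → ℕ, (∀ i, k i ≤ N i) → ∑ i, k i ≤ K →
      epsPosteriori β k N ≤ epsApriori m β K (⨅ i, N i)) ∧
    -- … that of `K` support scenarios in one and the same of `m` datasets of the smallest size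
    (K ≤ (⨅ i, N i) → ∀ i : Fin m,
      epsPosteriori β (Pi.single i K) (fun _ : Fin m => ⨅ l, N l) =
        epsApriori m β K (⨅ l, N l)) := by
  refine ⟨one_sub_le_measureReal_jointRisk_le hm P hmeas hcons hnd hK hβ.1, fun hKN => ?_,
    fun k _ hk => epsPosteriori_le_epsApriori hm hβ.1 hk, fun _ i => ?_⟩
  · have h := tLow_spec hβ.1 hKN
    exact ⟨⟨h.1, tLow_lt_one hβ hKN⟩, h.2.1⟩
  · have : Nonempty (Fin m) := ⟨i⟩
    exact epsPosteriori_single β K (le_ciInf hN) i
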